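/- Write $[k]=\{1,\dots,k\}$ and let $\mathcal S_d$ be the set of permutations $v=v_1\cdots v_d$ of $[d]$. For $v\in\mathcal S_d$ and a word $x=x_1\cdots x_n$ over a totally ordered alphabet, a consecutive occurrence of $v$ in $x$ is a factor $x_{j+1}\cdots x_{j+d}$ ($0\le j\le n-d$) that is order-isomorphic to $v$; let $\mathrm{con}_v(x)$ be their number. For $r\ge 0$ let $g_r^v([k]^n)$ (respectively $g_r^v(\mathcal S_n)$) be the number of words $x\in[k]^n$ (respectively permutations $x\in\mathcal S_n$) with $\mathrm{con}_v(x)=r$. Patterns $v,w$ are strongly c-Wilf-equivalent in words if $g_r^v([k]^n)=g_r^w([k]^n)$ for all $k,n\ge 1$ and $r\ge 0$, and strongly c-Wilf-equivalent in permutations if $g_r^v(\mathcal S_n)=g_r^w(\mathcal S_n)$ for all $n\ge1$ and $r\ge0$; without "strongly", only $r=0$ is required. Let $\mathcal O_v$ be the set of $i$ with $1\le i<d$ such that $v_1\cdots v_i$ and $v_{d-i+1}\cdots v_d$ are order-isomorphic. Theorem. Let $v,w\in\mathcal S_d$ be such that $\mathcal O_v=\mathcal O_w$ and, for every $i\in\mathcal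 O_v$, $$\{v_1,\dots,v_{d-i}\}=\{w_1,\dots,w_{d-i}\}\quad\text{and}\quad\{v_{i+1},\dots,v_d\}=\{w_{i+1},\dots,w_d\}.$$ Then $v$ and $w$ are c-Wilf-equivalent, and indeed strongly c-Wilf-equivalent, in words; consequently they are also c-Wilf-equivalent, and strongly c-Wilf-equivalent, in permutations. -/

import Mathlib

namespace ConsecutivePatterns

/-! Words of length `n` over an ordered alphabet `A` are functions `Fin n → A`. Positions and letters
are counted from `0`: the alphabet `[a]` is `Fin a`, and a permutation of `[n]` in one-line notation is
the word `⇑σ : Fin n → Fin n` of some `σ : Equiv.Perm (Fin n)`. -/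

/-- Two words of the same length are order-isomorphic (they have the same reduction). -/
def SameOrder {A B : Type*} [LinearOrder A] [LinearOrder B] {d : ℕ}
    (x : Fin d → A) (y : Fin d → B) : Prop :=
  ∀ p q : Fin d, (x p < x q ↔ y p < y q) ∧ (x p = x q ↔ y p = y q)

instance {A B : Type*} [LinearOrder A] [LinearOrder B] {d : ℕ}
    (x : Fin d → A) (y : Fin d → B) : Decidable (SameOrder x y) :=
  inferInstanceAs
    (Decidable (∀ p q : Fin d, (x p < x q ↔ y p < y q) ∧ (x p = x q ↔ y p = y q)))

/-- The factor of length `d` of the word `x` that starts at position `j`. The possible starting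
positions `j` are those with `j + d ≤ n`, that is, `j < n + 1 - d`. -/
def factor {A : Type*} {n : ℕ} (x : Fin n → A) (d : ℕ) (j : Fin (n + 1 - d)) : Fin d → A :=
  fun p => x ⟨j.val + p.val, by omega⟩

/-- The number of consecutive occurrences of the pattern `v` in the word `x`. -/
def con {A B : Type*} [LinearOrder A] [LinearOrder B] {d n : ℕ}
    (v : Fin d → B) (x : Fin n → A) : ℕ :=
  (Finset.univ.filter fun j : Fin (n + 1 - d) => SameOrder (factor x d j) v).card

/-- The number `g_r^v(S)` of words in `S` with exactly `r` consecutive occurrences of `v`. -/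
def g {A B : Type*} [LinearOrder A] [LinearOrder B] {d n : ℕ}
    (r : ℕ) (v : Fin d → B) (S : Finset (Fin n → A)) : ℕ :=
  (S.filter fun x => con v x = r).card

/-- The set `[a]^n` of all `a`-ary words of length `n`. -/
def allWords (a n : ℕ) : Finset (Fin n → Fin a) := Finset.univ

/-- The set of all permutations of `[n]`, as words in one-line notation. -/
def permWords (n : ℕ) : Finset (Fin n → Fin n) :=
  Finset.univ.map ⟨fun σ : Equiv.Perm (Fin n) => (σ : Fin n → Fin n), DFunLike.coe_injective⟩

/-- c-Wilf-equivalence in words. -/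
def CWilfWords {d : ℕ} (v w : Equiv.Perm (Fin d)) : Prop :=
  ∀ a n : ℕ, 1 ≤ a → 1 ≤ n → g 0 v (allWords a n) = g 0 w (allWords a n)

/-- Strong c-Wilf-equivalence in words. -/
def StrongCWilfWords {d : ℕ} (v w : Equiv.Perm (Fin d)) : Prop :=
  ∀ a n r : ℕ, 1 ≤ a → 1 ≤ n → g r v (allWords a n) = g r w (allWords a n)

/-- c-Wilf-equivalence in permutations. -/
def CWilfPerms {d : ℕ} (v w : Equiv.Perm (Fin d)) : Prop :=
  ∀ n : ℕ, 1 ≤ n → g 0 v (permWords n) = g 0 w (permWords n)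

/-- Strong c-Wilf-equivalence in permutations. -/
def StrongCWilfPerms {d : ℕ} (v w : Equiv.Perm (Fin d)) : Prop :=
  ∀ n r : ℕ, 1 ≤ n → g r v (permWords n) = g r w (permWords n)

/-- The overlap set of `v`: all `i` with `1 ≤ i < d` such that the first `i` entries and the last `i`
entries of `v` are order-isomorphic. -/
def overlaps {d : ℕ} (v : Equiv.Perm (Fin d)) : Set ℕ :=
  {i | 1 ≤ i ∧ ∃ _ : i < d,
    SameOrder (fun p : Fin i => v ⟨p.val, by omega⟩)
      (fun p : Fin i => v ⟨d - i + p.val, by omega⟩)}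

/-- The Khoroshkin–Shapiro/Nakamura condition. The two images are the sets of the first `d - i` entries
and of the last `d - i` entries. -/
def KSNCondition {d : ℕ} (v w : Equiv.Perm (Fin d)) : Prop :=
  overlaps v = overlaps w ∧
    ∀ i ∈ overlaps v,
      v '' {p : Fin d | p.val < d - i} = w '' {p : Fin d | p.val < d - i} ∧
      v '' {p : Fin d | i ≤ p.val} = w '' {p : Fin d | i ≤ p.val}

end ConsecutivePatterns

namespace ConsecutivePatterns

open Finset

/-! Fix a set `J` of starting positions. Applying `v⁻¹w` to the positions inside every window that
starts in `J` turns occurrences of `v` at all of `J` into occurrences of `w`. Overlapping windows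
give the same rule: the image hypotheses make `v⁻¹w` preserve the first `i` and the last `i`
positions, and the order isomorphisms defining the overlap sets force both actions to agree
(`symm_apply_shift`). So in any set of words closed under permuting positions, as many words have
`v` at all of `J` as have `w` there (`card_subset_occ_le`, used in both directions).
Inclusion–exclusion over `J` (`card_eq_of_card_subset_eq`) then equates the counts by exact
occurrence set. -/

/-- Two families with the same range that order a finite index set in the same way coincide. -/
theorem eq_of_range_eq_of_lt_iff {ι α : Type*} [Finite ι] [LinearOrder α] {f g : ι → α}
    (hf : Function.Injective f) (hlt : ∀ a b, f a < f b ↔ g a < g b)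
    (hr : Set.range f = Set.range g) : f = g := by
  -- In the order pulled back along `f`, both families are strictly increasing, and on a finite
  -- order such a family is determined by its range.
  let _ : LinearOrder ι := LinearOrder.lift' f hf
  have hfm : StrictMono f := fun a b hab => hab
  have hgm : StrictMono g := fun a b hab => (hlt a b).1 hab
  exact (StrictMono.range_inj hfm hgm).1 hr

/-! ### The position permutation `v⁻¹w` on overlaps -/

theorem KSNCondition.symm {d : ℕ} {v w : Equiv.Perm (Fin d)} (h : KSNCondition v w) :
    KSNCondition w v :=
  ⟨h.1.symm, fun i hi => ⟨(h.2 i (h.1 ▸ hi)).1.symm, (h.2 i (h.1 ▸ hi)).2.symm⟩⟩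

theorem symm_apply_mem_iff_of_image_eq {α : Type*} {v w : Equiv.Perm α} {s : Set α}
    (h : v '' s = w '' s) (a : α) : v.symm (w a) ∈ s ↔ a ∈ s := by
  constructor
  · intro ha
    have : w a ∈ v '' s := ⟨_, ha, by simp⟩
    rw [h] at this
    exact (w.injective.mem_set_image).1 this
  · intro ha
    have : w a ∈ v '' s := h ▸ ⟨a, ha, rfl⟩
    obtain ⟨b, hb, hba⟩ := this
    rwa [← hba, Equiv.symm_apply_apply]

/-- On an overlap of length `i`, the position permutation `v⁻¹ w` acts in the same way on the first
`i` and on the last `i` positions. -/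
theorem symm_apply_shift {d : ℕ} {v w : Equiv.Perm (Fin d)} (h : KSNCondition v w) {i : ℕ}
    (hi : i ∈ overlaps v) (p : ℕ) (hp : p < i) (hid : i ≤ d) :
    (v.symm (w ⟨d - i + p, by omega⟩) : ℕ) = d - i + (v.symm (w ⟨p, by omega⟩) : ℕ) := by
  obtain ⟨himg₁, himg₂⟩ := h.2 i hi
  have hiw : i ∈ overlaps w := h.1 ▸ hi
  obtain ⟨_, _, hv⟩ := hi
  obtain ⟨_, _, hw⟩ := hiw
  -- The first `d - i` positions are preserved, hence so is their complement.
  have hsuf : ∀ q : Fin i, d - i ≤ (v.symm (w ⟨d - i + q, by omega⟩) : ℕ) := by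
    intro q
    have := symm_apply_mem_iff_of_image_eq himg₁ ⟨d - i + q, by omega⟩
    simp only [Set.mem_ofPred_eq] at this
    omega
  have hpre : ∀ q : Fin i, (v.symm (w ⟨q, by omega⟩) : ℕ) < i := by
    intro q
    have := symm_apply_mem_iff_of_image_eq himg₂ ⟨q, by omega⟩
    simp only [Set.mem_ofPred_eq] at this
    omega
  let π₁ : Fin i → Fin i := fun q => ⟨v.symm (w ⟨q, by omega⟩), hpre q⟩
  let π₂ : Fin i → Fin i := fun q =>
    ⟨v.symm (w ⟨d - i + q, by omega⟩) - (d - i), by have := hsuf q; omega⟩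
  have hπ₁ : Function.Injective π₁ := by
    intro a b hab
    have := Fin.ext (Fin.mk.inj_iff.1 hab)
    simpa [Fin.ext_iff] using this
  have hπ₂ : Function.Injective π₂ := by
    intro a b hab
    have h1 := Fin.mk.inj_iff.1 hab
    have ha := hsuf a
    have hb := hsuf b
    have : v.symm (w ⟨d - i + a, by omega⟩) = v.symm (w ⟨d - i + b, by omega⟩) := by
      apply Fin.ext; omega
    simpa [Fin.ext_iff] using this
  let vp : Fin i → Fin d := fun q => v ⟨q, by omega⟩
  have hvp : Function.Injective vp := by
    intro a b hab
    simpa [vp, Fin.ext_iff] using hab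
  have h₁ : ∀ q, vp (π₁ q) = w ⟨q, by omega⟩ := fun q => by simp [vp, π₁]
  have h₂ : ∀ q, v ⟨d - i + π₂ q, by omega⟩ = w ⟨d - i + q, by omega⟩ := by
    intro q
    rw [← Equiv.eq_symm_apply]
    apply Fin.ext
    have := hsuf q
    simp only [π₂]
    omega
  -- Both sides list the first `i` entries of `v`. The left is ordered like the prefix of `w`, the
  -- right like its suffix (via the overlap of `v`), and these orders agree because `i` is an
  -- overlap of `w`.
  have key : vp ∘ π₁ = vp ∘ π₂ := by
    apply eq_of_range_eq_of_lt_iff (hvp.comp hπ₁)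
    · intro a b
      have e1 := (hw a b).1
      have e2 := (hv (π₂ a) (π₂ b)).1
      beta_reduce at e1 e2
      simp only [Function.comp_apply, h₁]
      rw [e1, ← h₂, ← h₂]
      exact e2.symm
    · rw [(Finite.surjective_of_injective hπ₁).range_comp,
        (Finite.surjective_of_injective hπ₂).range_comp]
  have := Fin.mk.inj_iff.1 (hvp (congrFun key ⟨p, hp⟩))
  have h3 := hsuf ⟨p, hp⟩
  simp only at this h3
  omega

/-! ### Gluing the window permutations -/

/-- Any two overlapping windows of length `d` that start at positions in `J` overlap in a length
from the overlap set of `v`. -/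
def Compatible {d n : ℕ} (v : Equiv.Perm (Fin d)) (J : Finset (Fin (n + 1 - d))) : Prop :=
  ∀ j ∈ J, ∀ j' ∈ J, j.val < j'.val → j'.val < j.val + d → d - (j'.val - j.val) ∈ overlaps v

open Classical in
/-- Apply `u` to the positions inside each window that starts in `J`. -/
noncomputable def windowMap {d n : ℕ} (u : Equiv.Perm (Fin d)) (J : Finset (Fin (n + 1 - d)))
    (q : Fin n) : Fin n :=
  if h : ∃ jp : Fin (n + 1 - d) × Fin d, jp.1 ∈ J ∧ jp.1.val + jp.2.val = q.val then
    ⟨h.choose.1.val + (u h.choose.2).val, by omega⟩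
  else q

theorem window_consistent {d n : ℕ} {v w : Equiv.Perm (Fin d)} (h : KSNCondition v w)
    {J : Finset (Fin (n + 1 - d))} (hJ : Compatible v J) {j j' : Fin (n + 1 - d)} (hj : j ∈ J)
    (hj' : j' ∈ J) {p p' : Fin d} (hpp : j.val + p.val = j'.val + p'.val)
    (hlt : j.val < j'.val) :
    j.val + (v.symm (w p)).val = j'.val + (v.symm (w p')).val := by
  have hi := hJ j hj j' hj' hlt (by omega)
  have := symm_apply_shift h hi p'.val (by omega) (by omega)
  have hp : (⟨d - (d - (j'.val - j.val)) + p'.val, by omega⟩ : Fin d) = p := by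
    apply Fin.ext; simp only; omega
  rw [hp] at this
  rw [this]
  simp only [Fin.eta]
  omega

/-- By `window_consistent` the window picked by `choose` is irrelevant. -/
theorem windowMap_val {d n : ℕ} {v w : Equiv.Perm (Fin d)} (h : KSNCondition v w)
    {J : Finset (Fin (n + 1 - d))} (hJ : Compatible v J) {j : Fin (n + 1 - d)} (hj : j ∈ J)
    (p : Fin d) {q : Fin n} (hq : j.val + p.val = q.val) :
    (windowMap (w.trans v.symm) J q).val = j.val + (v.symm (w p)).val := by
  have hex : ∃ jp : Fin (n + 1 - d) × Fin d, jp.1 ∈ J ∧ jp.1.val + jp.2.val = q.val :=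
    ⟨(j, p), hj, hq⟩
  rw [windowMap, dif_pos hex]
  obtain ⟨hmem, hval⟩ := hex.choose_spec
  simp only [Equiv.trans_apply]
  rcases lt_trichotomy j.val hex.choose.1.val with hlt | heq | hgt
  · exact (window_consistent h hJ hj hmem (hq.trans hval.symm) hlt).symm
  · have : hex.choose.2 = p := Fin.ext (by omega)
    rw [this, heq]
  · exact window_consistent h hJ hmem hj (hval.trans hq.symm) hgt

theorem windowMap_windowMap {d n : ℕ} {v w : Equiv.Perm (Fin d)} (h : KSNCondition v w)
    {J : Finset (Fin (n + 1 - d))} (hJ : Compatible v J) (q : Fin n) :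
    windowMap (v.trans w.symm) J (windowMap (w.trans v.symm) J q) = q := by
  have hJ' : Compatible w J := by unfold Compatible; rw [← h.1]; exact hJ
  by_cases hex : ∃ jp : Fin (n + 1 - d) × Fin d, jp.1 ∈ J ∧ jp.1.val + jp.2.val = q.val
  · obtain ⟨⟨j, p⟩, hj, hq⟩ := hex
    apply Fin.ext
    -- The image of `q` stays in window `j`, so the inverse can be computed in that same window.
    rw [windowMap_val h.symm hJ' hj (v.symm (w p)) (windowMap_val h hJ hj p hq).symm]
    simpa using hq
  · have : windowMap (w.trans v.symm) J q = q := by rw [windowMap, dif_neg hex]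
    rw [this, windowMap, dif_neg hex]

/-- The permutation of positions that turns occurrences of `v` at all positions of `J` into
occurrences of `w`. -/
noncomputable def windowPerm {d n : ℕ} {v w : Equiv.Perm (Fin d)} (h : KSNCondition v w)
    {J : Finset (Fin (n + 1 - d))} (hJ : Compatible v J) : Equiv.Perm (Fin n) where
  toFun := windowMap (w.trans v.symm) J
  invFun := windowMap (v.trans w.symm) J
  left_inv := windowMap_windowMap h hJ
  right_inv := windowMap_windowMap h.symm (by unfold Compatible; rw [← h.1]; exact hJ)

/-! ### Words with prescribed occurrences -/

/-- The starting positions of the consecutive occurrences of `v` in `x`. -/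
def occ {A B : Type*} [LinearOrder A] [LinearOrder B] {d n : ℕ} (v : Fin d → B) (x : Fin n → A) :
    Finset (Fin (n + 1 - d)) :=
  univ.filter fun j => SameOrder (factor x d j) v

theorem mem_occ {A B : Type*} [LinearOrder A] [LinearOrder B] {d n : ℕ} {v : Fin d → B}
    {x : Fin n → A} {j : Fin (n + 1 - d)} : j ∈ occ v x ↔ SameOrder (factor x d j) v := by
  simp [occ]

/-- The common part of two overlapping occurrences is order-isomorphic both to a suffix and to a
prefix of `v`. -/
theorem compatible_of_subset_occ {A : Type*} [LinearOrder A] {d n : ℕ} {v : Equiv.Perm (Fin d)}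
    {J : Finset (Fin (n + 1 - d))} {x : Fin n → A} (hx : J ⊆ occ v x) : Compatible v J := by
  intro j hj j' hj' hlt hlt'
  refine ⟨by omega, by omega, fun p q => ?_⟩
  have h1 := mem_occ.1 (hx hj)
  have h2 := mem_occ.1 (hx hj') ⟨p, by omega⟩ ⟨q, by omega⟩
  have h3 := h1 ⟨d - (d - (j'.val - j.val)) + p, by omega⟩
    ⟨d - (d - (j'.val - j.val)) + q, by omega⟩
  have e : ∀ r : Fin (d - (j'.val - j.val)),
      factor x d j ⟨d - (d - (j'.val - j.val)) + r, by omega⟩ = factor x d j' ⟨r, by omega⟩ := by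
    intro r
    unfold factor
    congr 1
    apply Fin.ext
    simp only
    omega
  rw [e p, e q] at h3
  exact ⟨h2.1.symm.trans h3.1, h2.2.symm.trans h3.2⟩

theorem subset_occ_comp_windowPerm {A : Type*} [LinearOrder A] {d n : ℕ}
    {v w : Equiv.Perm (Fin d)} (h : KSNCondition v w) {J : Finset (Fin (n + 1 - d))}
    (hJ : Compatible v J) {x : Fin n → A} (hx : J ⊆ occ v x) :
    J ⊆ occ w (x ∘ windowPerm h hJ) := by
  intro j hj
  rw [mem_occ]
  have e : ∀ p, factor (x ∘ windowPerm h hJ) d j p = factor x d j (v.symm (w p)) := by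
    intro p
    unfold factor
    simp only [Function.comp_apply]
    congr 1
    apply Fin.ext
    exact windowMap_val h hJ hj p rfl
  intro p q
  rw [e, e]
  simpa using mem_occ.1 (hx hj) (v.symm (w p)) (v.symm (w q))

theorem card_subset_occ_le {A : Type*} [LinearOrder A] {d n : ℕ} {v w : Equiv.Perm (Fin d)}
    (h : KSNCondition v w) {S : Finset (Fin n → A)}
    (hS : ∀ x ∈ S, ∀ τ : Equiv.Perm (Fin n), x ∘ τ ∈ S) (J : Finset (Fin (n + 1 - d))) :
    #{x ∈ S | J ⊆ occ v x} ≤ #{x ∈ S | J ⊆ occ w x} := by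
  by_cases hJ : Compatible v J
  · refine card_le_card_of_injOn (fun x => x ∘ windowPerm h hJ) ?_ ?_
    · intro x hx
      have hx := mem_filter.1 hx
      exact mem_filter.2 ⟨hS x hx.1 _, subset_occ_comp_windowPerm h hJ hx.2⟩
    · exact fun x _ y _ hxy => (windowPerm h hJ).surjective.injective_comp_right hxy
  -- For incompatible `J` no word has `v` at all of `J`.
  · rw [filter_eq_empty_iff.2 fun x _ hx => hJ (compatible_of_subset_occ hx)]
    simp

/-! ### From containment to exact occurrence sets -/

/-- If the numbers of elements whose value under `f` and under `g` contains `J` agree for all `J`,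
then so do the numbers of elements whose value is exactly `J`. -/
theorem card_eq_of_card_subset_eq {α β : Type*} [Fintype β] [DecidableEq β] (S : Finset α)
    (f g : α → Finset β) (h : ∀ J, #{x ∈ S | J ⊆ f x} = #{x ∈ S | J ⊆ g x}) (J : Finset β) :
    #{x ∈ S | f x = J} = #{x ∈ S | g x = J} := by
  have split : ∀ (f : α → Finset β) (J : Finset β),
      #{x ∈ S | J ⊆ f x} = #{x ∈ S | f x = J} + ∑ K with J ⊂ K, #{x ∈ S | f x = K} := by
    intro f J
    have hIci : (univ.filter (J ⊆ ·) : Finset (Finset β)) = insert J (univ.filter (J ⊂ ·)) := by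
      ext K
      simp [subset_iff_ssubset_or_eq, eq_comm, or_comm]
    rw [card_eq_sum_card_fiberwise (f := f) (t := univ.filter (J ⊆ ·))]
    · rw [hIci, sum_insert (by simp)]
      congr 1
      · congr 1
        ext x
        simp only [mem_filter]
        exact ⟨fun h => ⟨h.1.1, h.2⟩, fun h => ⟨⟨h.1, h.2.symm.subset⟩, h.2⟩⟩
      · refine sum_congr rfl fun K hK => ?_
        congr 1
        ext x
        simp only [mem_filter]
        exact ⟨fun h => ⟨h.1.1, h.2⟩,
          fun h => ⟨⟨h.1, h.2.symm ▸ (mem_filter.1 hK).2.subset⟩, h.2⟩⟩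
    · intro x hx
      simpa using (mem_filter.1 hx).2
  -- Downward induction on `J`: the strictly larger sets are already settled.
  induction hc : Fintype.card β - #J using Nat.strong_induction_on generalizing J with
  | _ m ih =>
    have hsum : ∑ K with J ⊂ K, #{x ∈ S | f x = K} = ∑ K with J ⊂ K, #{x ∈ S | g x = K} := by
      refine sum_congr rfl fun K hK => ih _ ?_ K rfl
      have h1 := card_lt_card (mem_filter.1 hK).2
      have h2 := card_le_univ K
      omega
    have := h J
    rw [split f, split g] at this
    omega

theorem g_eq_sum_card_occ {A B : Type*} [LinearOrder A] [LinearOrder B] {d n : ℕ} (r : ℕ)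
    (v : Fin d → B) (S : Finset (Fin n → A)) :
    g r v S = ∑ J : Finset (Fin (n + 1 - d)) with #J = r, #{x ∈ S | occ v x = J} := by
  unfold g
  rw [card_eq_sum_card_fiberwise (f := occ v) (t := univ.filter (#· = r))]
  · refine sum_congr rfl fun J hJ => ?_
    congr 1
    ext x
    simp only [mem_filter]
    refine ⟨fun h => ⟨h.1.1, h.2⟩, fun h => ⟨⟨h.1, ?_⟩, h.2⟩⟩
    rw [← (mem_filter.1 hJ).2, ← h.2]
    rfl
  · intro x hx
    exact mem_filter.2 ⟨mem_univ _, (mem_filter.1 hx).2⟩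

theorem g_eq_of_ksnCondition {A : Type*} [LinearOrder A] {d n : ℕ} {v w : Equiv.Perm (Fin d)}
    (h : KSNCondition v w) {S : Finset (Fin n → A)}
    (hS : ∀ x ∈ S, ∀ τ : Equiv.Perm (Fin n), x ∘ τ ∈ S) (r : ℕ) : g r v S = g r w S := by
  rw [g_eq_sum_card_occ, g_eq_sum_card_occ]
  exact sum_congr rfl fun J _ => card_eq_of_card_subset_eq S _ _
    (fun K => (card_subset_occ_le h hS K).antisymm (card_subset_occ_le h.symm hS K)) J

theorem comp_mem_permWords {n : ℕ} (x : Fin n → Fin n) (hx : x ∈ permWords n)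
    (τ : Equiv.Perm (Fin n)) : x ∘ τ ∈ permWords n := by
  obtain ⟨σ, -, rfl⟩ := mem_map.1 hx
  exact mem_map.2 ⟨τ.trans σ, mem_univ _, rfl⟩

end ConsecutivePatterns

theorem theorem1 (d : ℕ) (v w : Equiv.Perm (Fin d))
    (h : ConsecutivePatterns.KSNCondition v w) :
    (ConsecutivePatterns.CWilfWords v w ∧ ConsecutivePatterns.StrongCWilfWords v w) ∧
      (ConsecutivePatterns.CWilfPerms v w ∧ ConsecutivePatterns.StrongCWilfPerms v w) := by
  have hwords : ConsecutivePatterns.StrongCWilfWords v w := fun _ _ r _ _ =>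
    ConsecutivePatterns.g_eq_of_ksnCondition h (fun _ _ _ => Finset.mem_univ _) r
  have hperms : ConsecutivePatterns.StrongCWilfPerms v w := fun _ r _ =>
    ConsecutivePatterns.g_eq_of_ksnCondition h ConsecutivePatterns.comp_mem_permWords r
  exact ⟨⟨fun a n => hwords a n 0, hwords⟩, ⟨fun n => hperms n 0, hperms⟩⟩
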